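/- For integers $n,\alpha\ge 0$ let $$L_n^{\alpha}(x)=\sum_{k=0}^{n}\frac{(-1)^k}{k!}\binom{n+\alpha}{n-k}x^k$$ be the generalized Laguerre polynomial, and put $L_n=L_n^0$. Then for every integer $n\ge 0$ and all $u,v\in\mathbb{C}$, $$\sum_{\ell=0}^{n}\frac{(2\ell+1)\,(n-\ell)!}{(n+\ell+1)!}\,(uv)^{\ell}\,L_{n-\ell}^{2\ell+1}(u)\,L_{n-\ell}^{2\ell+1}(v)=\frac{u\,L_{n}^{1}(u)\,L_{n+1}(v)-v\,L_{n}^{1}(v)\,L_{n+1}(u)}{u-v},$$ where the right-hand side is a polynomial in $u$ and $v$; for $u=v$ it stands for the value of this polynomial, that is, for the limit of the quotient at $(u,u)$ taken over pairs of distinct complex numbers. Moreover, for all $u,v\in\mathbb{C}$, $$\sum_{\ell=0}^{n}(-1)^{\ell}\,\frac{(2\ell+1)\,(n-\ell)!}{(n+\ell+1)!}\,(uv)^{\ell}\,L_{n-\ell}^{2\ell+1}(u)\,L_{n-\ell}^{2\ell+1}(v)=L_{n}^{1}(u+v).$$ -/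

import Mathlib

open Filter Topology

/-- The generalized (associated) Laguerre polynomial
`L_n^α(x) = ∑_{k=0}^n (-1)^k * binom(n+α, n-k) * x^k / k!`
with complex coefficients, of degree `n` and with upper index `α ∈ {0, 1, 2, …}`.
The ordinary Laguerre polynomial `L_n` is `laguerre n 0`. -/
noncomputable def laguerre (n α : ℕ) : Polynomial ℂ :=
  ∑ k ∈ Finset.range (n + 1),
    Polynomial.C ((-1 : ℂ) ^ k * ((n + α).choose (n - k) : ℂ) / (k.factorial : ℂ)) *
      Polynomial.X ^ k

/-! Both identities are compared coefficientwise in `u ^ a * v ^ b`; by `sum_laguerre_eq` each left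
side reduces to a sum of `summand n a b l` over `l`, with sign `ε ^ l`, `ε = ±1`. For `ε = -1`,
creative telescoping in `l` gives a first-order recurrence in `a` (`alternating_sum_summand_succ`),
which the closed form in `alternating_sum_summand` solves. For `ε = 1`, multiplying by `u - v` turns
the coefficient into a combination of the sums at `(a - 1, b)` and `(a, b - 1)`, and this
combination telescopes (`sum_summand_sub`). -/

/-! ### Reciprocal factorials on the integers -/

/-- The reciprocal factorial `1 / k!`, extended by zero to negative integers. -/
noncomputable def invFactorial (k : ℤ) : ℂ :=
  if 0 ≤ k then ((k.toNat.factorial : ℕ) : ℂ)⁻¹ else 0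

theorem invFactorial_natCast (k : ℕ) : invFactorial k = ((k.factorial : ℕ) : ℂ)⁻¹ := by
  simp [invFactorial]

theorem invFactorial_of_neg {k : ℤ} (hk : k < 0) : invFactorial k = 0 := by
  simp [invFactorial, hk]

/-- Extension by zero respects the recursion: at `k = -1` the factor `k + 1` vanishes. This spares
case distinctions at the ends of the sums. -/
theorem invFactorial_eq_mul_succ (k : ℤ) :
    invFactorial k = ((k : ℂ) + 1) * invFactorial (k + 1) := by
  rcases lt_trichotomy k (-1) with h | h | h
  · rw [invFactorial_of_neg (by omega), invFactorial_of_neg (by omega), mul_zero]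
  · subst h
    simp [invFactorial]
  · lift k to ℕ using by omega
    have h1 : ((k : ℤ) + 1) = ((k + 1 : ℕ) : ℤ) := by push_cast; rfl
    have h2 : ((k : ℂ) + 1) ≠ 0 := by exact_mod_cast k.succ_ne_zero
    have h3 : ((k.factorial : ℕ) : ℂ) ≠ 0 := by exact_mod_cast k.factorial_ne_zero
    rw [h1, invFactorial_natCast, invFactorial_natCast, Nat.factorial_succ]
    push_cast
    field_simp

/-- A version of the recursion with both integer arguments free. -/
theorem invFactorial_eq_mul {j k : ℤ} (h : k = j + 1) {c : ℂ} (hc : c = (k : ℂ)) :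
    invFactorial j = c * invFactorial k := by
  subst h hc
  rw [invFactorial_eq_mul_succ]
  push_cast
  rfl

theorem factorial_mul_invFactorial (k : ℕ) :
    ((k.factorial : ℕ) : ℂ) * invFactorial k = 1 := by
  rw [invFactorial_natCast]
  exact mul_inv_cancel₀ (by exact_mod_cast k.factorial_ne_zero)

/-! ### Coefficient expansions -/

theorem eval_laguerre (m α : ℕ) (u : ℂ) :
    (laguerre m α).eval u = ∑ k ∈ Finset.range (m + 1),
      (-1 : ℂ) ^ k * ((m + α).factorial : ℂ) * invFactorial ((m : ℤ) - k) *
        invFactorial ((α : ℤ) + k) * invFactorial k * u ^ k := by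
  rw [laguerre, Polynomial.eval_finsetSum]
  refine Finset.sum_congr rfl fun k hk => ?_
  have hk : k ≤ m := by simpa [Nat.lt_succ_iff] using hk
  have h1 : (m : ℤ) - k = ((m - k : ℕ) : ℤ) := by omega
  have h2 : (α : ℤ) + k = ((α + k : ℕ) : ℤ) := by omega
  rw [h1, h2, invFactorial_natCast, invFactorial_natCast, invFactorial_natCast,
    Nat.cast_choose ℂ (show m - k ≤ m + α by omega), show m + α - (m - k) = α + k by omega]
  simp only [Polynomial.eval_mul, Polynomial.eval_C, Polynomial.eval_pow, Polynomial.eval_X]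
  field_simp

/-- Reindexing by `a = l + k` makes the range independent of `l`, so that sums over `l` and `a` can
be exchanged; terms with `a < l` vanish. -/
theorem pow_mul_eval_laguerre {n l : ℕ} (hl : l ≤ n) (u : ℂ) :
    u ^ l * (laguerre (n - l) (2 * l + 1)).eval u = ∑ a ∈ Finset.range (n + 1),
      (-1 : ℂ) ^ a * (-1) ^ l * ((n + l + 1).factorial : ℂ) * invFactorial ((n : ℤ) - a) *
        invFactorial ((a : ℤ) + l + 1) * invFactorial ((a : ℤ) - l) * u ^ a := by
  rw [show n + 1 = l + (n - l + 1) by omega, Finset.sum_range_add, Finset.sum_eq_zero, zero_add,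
    eval_laguerre, Finset.mul_sum]
  · refine Finset.sum_congr rfl fun k hk => ?_
    rw [show n - l + (2 * l + 1) = n + l + 1 by omega,
      show ((n - l : ℕ) : ℤ) - k = (n : ℤ) - ((l + k : ℕ) : ℤ) by omega,
      show ((2 * l + 1 : ℕ) : ℤ) + k = ((l + k : ℕ) : ℤ) + l + 1 by omega,
      show (((l + k : ℕ) : ℤ) - l) = k by omega, pow_add, pow_add]
    have : (-1 : ℂ) ^ l * (-1) ^ l = 1 := by rw [← mul_pow]; simp
    linear_combination (-(-1 : ℂ) ^ k * ((n + l + 1).factorial : ℂ) *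
      invFactorial ((n : ℤ) - ((l + k : ℕ) : ℤ)) *
      invFactorial (((l + k : ℕ) : ℤ) + l + 1) * invFactorial k * u ^ l * u ^ k) * this
  · intro a ha
    rw [invFactorial_of_neg (k := (a : ℤ) - l) (by simp at ha; omega)]
    ring

/-- The contribution of the index `l` to the coefficient of `u ^ a * v ^ b` in
`mainTheorem6`, up to a factor independent of `l`. -/
noncomputable def summand (n : ℕ) (a b : ℤ) (l : ℕ) : ℂ :=
  (2 * (l : ℂ) + 1) * ((n - l).factorial : ℂ) * ((n + l + 1).factorial : ℂ) *
    invFactorial (a - l) * invFactorial (a + l + 1) *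
    invFactorial (b - l) * invFactorial (b + l + 1)

theorem sum_laguerre_eq (n : ℕ) (ε u v : ℂ) :
    ∑ l ∈ Finset.range (n + 1), ε ^ l *
        ((2 * (l : ℂ) + 1) * ((n - l).factorial : ℂ) / ((n + l + 1).factorial : ℂ)) *
          (u * v) ^ l * (laguerre (n - l) (2 * l + 1)).eval u *
            (laguerre (n - l) (2 * l + 1)).eval v
      = ∑ a ∈ Finset.range (n + 1), ∑ b ∈ Finset.range (n + 1),
        (-1 : ℂ) ^ a * (-1) ^ b * invFactorial ((n : ℤ) - a) * invFactorial ((n : ℤ) - b) *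
          (∑ l ∈ Finset.range (n + 1), ε ^ l * summand n a b l) * u ^ a * v ^ b := by
  have key : ∀ l ∈ Finset.range (n + 1), ε ^ l *
        ((2 * (l : ℂ) + 1) * ((n - l).factorial : ℂ) / ((n + l + 1).factorial : ℂ)) *
          (u * v) ^ l * (laguerre (n - l) (2 * l + 1)).eval u *
            (laguerre (n - l) (2 * l + 1)).eval v
      = ∑ a ∈ Finset.range (n + 1), ∑ b ∈ Finset.range (n + 1),
        (-1 : ℂ) ^ a * (-1) ^ b * invFactorial ((n : ℤ) - a) * invFactorial ((n : ℤ) - b) *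
          (ε ^ l * summand n a b l) * u ^ a * v ^ b := by
    intro l hl
    have hl : l ≤ n := by simpa [Nat.lt_succ_iff] using hl
    calc _ = ε ^ l *
          ((2 * (l : ℂ) + 1) * ((n - l).factorial : ℂ) / ((n + l + 1).factorial : ℂ)) *
          ((u ^ l * (laguerre (n - l) (2 * l + 1)).eval u) *
            (v ^ l * (laguerre (n - l) (2 * l + 1)).eval v)) := by rw [mul_pow]; ring
      _ = _ := by
        rw [pow_mul_eval_laguerre hl, pow_mul_eval_laguerre hl, Finset.sum_mul_sum,
          Finset.mul_sum]
        refine Finset.sum_congr rfl fun a _ => ?_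
        rw [Finset.mul_sum]
        refine Finset.sum_congr rfl fun b _ => ?_
        have h1 : (-1 : ℂ) ^ l * (-1) ^ l = 1 := by rw [← mul_pow]; simp
        have h2 : ((n + l + 1).factorial : ℂ)⁻¹ * ((n + l + 1).factorial : ℂ) = 1 :=
          inv_mul_cancel₀ (by exact_mod_cast (n + l + 1).factorial_ne_zero)
        rw [summand, div_eq_mul_inv]
        generalize ((n + l + 1).factorial : ℂ)⁻¹ = G at h2 ⊢
        generalize ((n + l + 1).factorial : ℂ) = F at h2 ⊢
        generalize (-1 : ℂ) ^ l = s at h1 ⊢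
        linear_combination (ε ^ l * (2 * (l : ℂ) + 1) * ((n - l).factorial : ℂ) * F *
          (-1) ^ a * (-1) ^ b * invFactorial ((n : ℤ) - a) * invFactorial ((n : ℤ) - b) *
          invFactorial ((a : ℤ) - l) * invFactorial ((a : ℤ) + l + 1) *
          invFactorial ((b : ℤ) - l) * invFactorial ((b : ℤ) + l + 1) * u ^ a * v ^ b) *
          (s * s * h2 + h1)
  rw [Finset.sum_congr rfl key, Finset.sum_comm]
  refine Finset.sum_congr rfl fun a _ => ?_
  rw [Finset.sum_comm]
  refine Finset.sum_congr rfl fun b _ => ?_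
  rw [Finset.mul_sum, Finset.sum_mul, Finset.sum_mul]

/-! ### The alternating sum -/

/-- The telescoping antidifference behind the alternating sum of `summand`. -/
theorem alternating_summand_telescope (n : ℕ) (a b : ℤ) {l : ℕ} (hl : l ≤ n) :
    ((n : ℂ) - a) * (a + b + 2) * (a + 1) * ((-1) ^ l * summand n (a + 1) b l)
        - (n - a - b) * ((-1) ^ l * summand n a b l)
      = (-1) ^ l * l * ((n + 1 - l).factorial : ℂ) * ((n + l + 1).factorial : ℂ) *
          invFactorial (a + 1 - l) * invFactorial (a + l + 1) *
          invFactorial (b - l) * invFactorial (b + l)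
        - (-1) ^ (l + 1) * ((l + 1 : ℕ) : ℂ) * ((n + 1 - (l + 1)).factorial : ℂ) *
          ((n + (l + 1) + 1).factorial : ℂ) *
          invFactorial (a + 1 - (l + 1 : ℕ)) * invFactorial (a + (l + 1 : ℕ) + 1) *
          invFactorial (b - (l + 1 : ℕ)) * invFactorial (b + (l + 1 : ℕ)) := by
  -- With `n = l + m` no truncated subtraction remains; once all factorials are reduced to common
  -- ones, a polynomial identity is left.
  obtain ⟨m, rfl⟩ := Nat.exists_eq_add_of_le hl
  rw [summand, summand, show l + m - l = m by omega, show l + m + 1 - l = m + 1 by omega,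
    show l + m + 1 - (l + 1) = m by omega,
    show l + m + (l + 1) + 1 = (l + m + l + 1) + 1 by omega,
    Nat.factorial_succ m, Nat.factorial_succ (l + m + l + 1),
    invFactorial_eq_mul (j := a - l) (k := a + 1 - l) (by ring) rfl,
    invFactorial_eq_mul (j := a + l + 1) (k := a + 1 + l + 1) (by ring) rfl,
    invFactorial_eq_mul (j := a + 1 - (l + 1 : ℕ)) (k := a + 1 - l) (by push_cast; ring) rfl,
    invFactorial_eq_mul (j := b - (l + 1 : ℕ)) (k := b - l) (by push_cast; ring) rfl,
    invFactorial_eq_mul (j := b + l) (k := b + l + 1) (by ring) rfl,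
    show a + (l + 1 : ℕ) + 1 = a + 1 + l + 1 by push_cast; ring,
    show b + (l + 1 : ℕ) = b + l + 1 by push_cast; ring]
  push_cast
  ring

theorem alternating_sum_summand_succ (n : ℕ) (a : ℤ) {b : ℤ} (hb : b ≤ n) :
    ((n : ℂ) - a) * (a + b + 2) * (a + 1) *
        ∑ l ∈ Finset.range (n + 1), (-1) ^ l * summand n (a + 1) b l
      = (n - a - b) * ∑ l ∈ Finset.range (n + 1), (-1) ^ l * summand n a b l := by
  rw [← sub_eq_zero, Finset.mul_sum, Finset.mul_sum, ← Finset.sum_sub_distrib]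
  rw [Finset.sum_congr rfl fun l hl => alternating_summand_telescope n a b
    (l := l) (by simpa [Nat.lt_succ_iff] using hl)]
  rw [Finset.sum_range_sub' (fun l : ℕ => (-1) ^ l * (l : ℂ) * ((n + 1 - l).factorial : ℂ) *
    ((n + l + 1).factorial : ℂ) * invFactorial (a + 1 - l) * invFactorial (a + l + 1) *
    invFactorial (b - l) * invFactorial (b + l))]
  -- The boundary term at `l = n + 1` vanishes since `b ≤ n`, the one at `l = 0` by its factor `l`.
  rw [invFactorial_of_neg (k := b - (n + 1 : ℕ)) (by push_cast; omega)]
  simp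

theorem alternating_sum_summand (n a b : ℕ) (hb : b ≤ n) :
    invFactorial ((n : ℤ) - a) * invFactorial ((n : ℤ) - b) *
        ∑ l ∈ Finset.range (n + 1), (-1) ^ l * summand n a b l
      = ((n + 1).factorial : ℂ) * invFactorial ((n : ℤ) - (a + b : ℕ)) *
        invFactorial ((a + b : ℕ) + 1) * invFactorial a * invFactorial b := by
  induction a with
  | zero =>
    rw [Finset.sum_range_succ', Finset.sum_eq_zero]
    · have h := factorial_mul_invFactorial n
      have h1 : invFactorial 1 = 1 := by simp [invFactorial]
      have h0 : invFactorial 0 = 1 := by simp [invFactorial]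
      simp only [summand, Nat.cast_zero, sub_zero, zero_add, add_zero, Nat.sub_zero, h1, h0]
      linear_combination (invFactorial ((n : ℤ) - b) * ((n + 1).factorial : ℂ) *
        invFactorial ((b : ℤ) + 1) * invFactorial b) * h
    · intro l _
      rw [summand, invFactorial_of_neg (k := ((0 : ℕ) : ℤ) - (l + 1 : ℕ)) (by omega)]
      ring
  | succ a ih =>
    have h := alternating_sum_summand_succ n (a : ℤ) (b := b) (by exact_mod_cast hb)
    rw [invFactorial_eq_mul (j := ((a + b : ℕ) : ℤ) + 1) (k := ((a + 1 + b : ℕ) : ℤ) + 1)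
        (by push_cast; ring) rfl,
      invFactorial_eq_mul (j := (a : ℤ)) (k := ((a + 1 : ℕ) : ℤ)) (by push_cast; ring) rfl] at ih
    -- The factor `n - a` of the recurrence is absorbed here, so it is never divided by and `a ≥ n`
    -- needs no separate case.
    rw [invFactorial_eq_mul (j := (n : ℤ) - (a + 1 : ℕ)) (k := (n : ℤ) - a)
        (by push_cast; ring) rfl,
      invFactorial_eq_mul (j := (n : ℤ) - (a + 1 + b : ℕ)) (k := (n : ℤ) - (a + b : ℕ))
        (by push_cast; ring) rfl]
    have h1 : ((a : ℂ) + b + 2) ≠ 0 := by exact_mod_cast (a + b + 1).succ_ne_zero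
    have h2 : ((a : ℂ) + 1) ≠ 0 := by exact_mod_cast a.succ_ne_zero
    apply mul_left_cancel₀ (mul_ne_zero h1 h2)
    push_cast at h ih ⊢
    linear_combination invFactorial ((n : ℤ) - a) * invFactorial ((n : ℤ) - b) * h +
      ((n : ℂ) - a - b) * ih

theorem eval_laguerre_one_add (n : ℕ) (u v : ℂ) :
    (laguerre n 1).eval (u + v)
      = ∑ a ∈ Finset.range (n + 1), ∑ b ∈ Finset.range (n + 1),
        (-1 : ℂ) ^ a * (-1) ^ b * (((n + 1).factorial : ℂ) *
          invFactorial ((n : ℤ) - (a + b : ℕ)) * invFactorial ((a + b : ℕ) + 1) *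
          invFactorial a * invFactorial b) * u ^ a * v ^ b := by
  set f : ℕ → ℕ → ℂ := fun a b => (-1 : ℂ) ^ a * (-1) ^ b * (((n + 1).factorial : ℂ) *
          invFactorial ((n : ℤ) - (a + b : ℕ)) * invFactorial ((a + b : ℕ) + 1) *
          invFactorial a * invFactorial b) * u ^ a * v ^ b with hf
  -- The square of indices shrinks to the triangle `a + b ≤ n`, where the binomial theorem applies.
  have hext : ∀ a ∈ Finset.range (n + 1), ∑ b ∈ Finset.range (n + 1), f a b
      = ∑ b ∈ Finset.range (n + 1 - a), f a b := by
    intro a _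
    refine (Finset.sum_subset (Finset.range_mono (by omega)) fun b _ hb => ?_).symm
    simp only [Finset.mem_range, not_lt] at hb
    simp only [hf]
    rw [invFactorial_of_neg (k := (n : ℤ) - (a + b : ℕ)) (by omega)]
    ring
  rw [Finset.sum_congr rfl hext, ← Finset.sum_range_diag_flip, eval_laguerre]
  refine Finset.sum_congr rfl fun k _ => ?_
  rw [add_pow, Finset.mul_sum]
  refine Finset.sum_congr rfl fun a ha => ?_
  obtain ⟨b, rfl⟩ := Nat.exists_eq_add_of_le (show a ≤ k by
    simpa [Nat.lt_succ_iff] using ha)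
  simp only [hf]
  rw [Nat.cast_choose ℂ (show a ≤ a + b by omega), show a + b - a = b by omega,
    invFactorial_natCast (a + b), invFactorial_natCast a, invFactorial_natCast b,
    show ((1 : ℕ) : ℤ) + ((a + b : ℕ) : ℤ) = ((a + b : ℕ) : ℤ) + 1 by push_cast; ring, pow_add]
  have := (a + b).factorial_ne_zero
  field_simp

theorem sum_laguerre_alternating (n : ℕ) (u v : ℂ) :
    ∑ l ∈ Finset.range (n + 1),
        (-1 : ℂ) ^ l *
          ((2 * (l : ℂ) + 1) * ((n - l).factorial : ℂ) / ((n + l + 1).factorial : ℂ)) *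
          (u * v) ^ l * (laguerre (n - l) (2 * l + 1)).eval u *
            (laguerre (n - l) (2 * l + 1)).eval v
      = (laguerre n 1).eval (u + v) := by
  rw [sum_laguerre_eq, eval_laguerre_one_add]
  refine Finset.sum_congr rfl fun a _ => Finset.sum_congr rfl fun b hb => ?_
  rw [← alternating_sum_summand n a b (by simpa [Nat.lt_succ_iff] using hb)]
  ring

/-! ### The sum without signs -/

/-- The telescoping antidifference behind the sum of `summand`. -/
theorem summand_telescope (n : ℕ) (a b : ℤ) {l : ℕ} (hl : l ≤ n) :
    ((n : ℂ) + 1 - b) * summand n (a - 1) b l - (n + 1 - a) * summand n a (b - 1) l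
      = (a - b) * (((n + 1 - l).factorial : ℂ) * ((n + l + 1).factorial : ℂ) *
          invFactorial (a - l) * invFactorial (a + l) *
          invFactorial (b - l) * invFactorial (b + l))
        - (a - b) * (((n + 1 - (l + 1)).factorial : ℂ) * ((n + (l + 1) + 1).factorial : ℂ) *
          invFactorial (a - (l + 1 : ℕ)) * invFactorial (a + (l + 1 : ℕ)) *
          invFactorial (b - (l + 1 : ℕ)) * invFactorial (b + (l + 1 : ℕ))) := by
  obtain ⟨m, rfl⟩ := Nat.exists_eq_add_of_le hl
  rw [summand, summand, show l + m - l = m by omega, show l + m + 1 - l = m + 1 by omega,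
    show l + m + 1 - (l + 1) = m by omega,
    show l + m + (l + 1) + 1 = (l + m + l + 1) + 1 by omega,
    Nat.factorial_succ m, Nat.factorial_succ (l + m + l + 1),
    show a + (l + 1 : ℕ) = a + l + 1 by push_cast; ring,
    show b + (l + 1 : ℕ) = b + l + 1 by push_cast; ring,
    show a - 1 + l + 1 = a + l by ring, show b - 1 + l + 1 = b + l by ring,
    invFactorial_eq_mul (j := a - 1 - l) (k := a - l) (by ring) rfl,
    invFactorial_eq_mul (j := b - 1 - l) (k := b - l) (by ring) rfl,
    invFactorial_eq_mul (j := a - (l + 1 : ℕ)) (k := a - l) (by push_cast; ring) rfl,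
    invFactorial_eq_mul (j := b - (l + 1 : ℕ)) (k := b - l) (by push_cast; ring) rfl,
    invFactorial_eq_mul (j := a + l) (k := a + l + 1) (by ring) rfl,
    invFactorial_eq_mul (j := b + l) (k := b + l + 1) (by ring) rfl]
  push_cast
  ring

theorem sum_summand_sub {n : ℕ} {a b : ℤ} (ha : a ≤ n + 1) (hb : b ≤ n + 1) :
    ((n : ℂ) + 1 - b) * ∑ l ∈ Finset.range (n + 1), summand n (a - 1) b l
        - (n + 1 - a) * ∑ l ∈ Finset.range (n + 1), summand n a (b - 1) l
      = (a - b) * ((n + 1).factorial : ℂ) ^ 2 * invFactorial a ^ 2 * invFactorial b ^ 2 := by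
  rw [Finset.mul_sum, Finset.mul_sum, ← Finset.sum_sub_distrib]
  rw [Finset.sum_congr rfl fun l hl => summand_telescope n a b
    (l := l) (by simpa [Nat.lt_succ_iff] using hl)]
  rw [Finset.sum_range_sub' (fun l : ℕ => ((a : ℂ) - b) * (((n + 1 - l).factorial : ℂ) *
    ((n + l + 1).factorial : ℂ) * invFactorial (a - l) * invFactorial (a + l) *
    invFactorial (b - l) * invFactorial (b + l)))]
  -- The upper boundary term could survive only at `a = b = n + 1`, where `a - b` kills it.
  have h : ((a : ℂ) - b) *
      (invFactorial (a - (n + 1 : ℕ)) * invFactorial (b - (n + 1 : ℕ))) = 0 := by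
    rcases lt_trichotomy a b with h | h | h
    · rw [invFactorial_of_neg (k := a - (n + 1 : ℕ)) (by push_cast; omega)]
      ring
    · rw [h]
      ring
    · rw [invFactorial_of_neg (k := b - (n + 1 : ℕ)) (by push_cast; omega)]
      ring
  simp only [Nat.cast_zero, sub_zero, add_zero, Nat.sub_zero]
  linear_combination -(((n + 1 - (n + 1)).factorial : ℂ) * ((n + (n + 1) + 1).factorial : ℂ) *
    invFactorial (a + (n + 1 : ℕ)) * invFactorial (b + (n + 1 : ℕ))) * h

theorem summand_neg_one_left (n l : ℕ) (b : ℤ) : summand n (-1) b l = 0 := by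
  rw [summand, invFactorial_of_neg (k := -1 - (l : ℤ)) (by omega)]
  ring

theorem summand_neg_one_right (n l : ℕ) (a : ℤ) : summand n a (-1) l = 0 := by
  rw [summand, invFactorial_of_neg (k := -1 - (l : ℤ)) (by omega)]
  ring

/-- The coefficients are `-a` times those of `L_{n+1}`, so the numerator in the first identity has
coefficients `b - a` times those of `L_{n+1}(u) L_{n+1}(v)`. -/
theorem mul_eval_laguerre_one (n : ℕ) (u : ℂ) :
    u * (laguerre n 1).eval u = ∑ a ∈ Finset.range (n + 2),
      -(-1 : ℂ) ^ a * a * ((n + 1).factorial : ℂ) * invFactorial ((n : ℤ) + 1 - a) *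
        invFactorial a ^ 2 * u ^ a := by
  rw [eval_laguerre, Finset.sum_range_succ' _ (n + 1), Finset.mul_sum]
  simp only [Nat.cast_zero, mul_zero, zero_mul, add_zero]
  refine Finset.sum_congr rfl fun a _ => ?_
  rw [invFactorial_eq_mul (j := (a : ℤ)) (k := ((a + 1 : ℕ) : ℤ)) (by push_cast; ring) rfl,
    show ((1 : ℕ) : ℤ) + a = ((a + 1 : ℕ) : ℤ) by push_cast; ring,
    show (n : ℤ) + 1 - ((a + 1 : ℕ) : ℤ) = n - a by push_cast; ring]
  push_cast
  ring

theorem eval_laguerre_succ_zero (n : ℕ) (u : ℂ) :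
    (laguerre (n + 1) 0).eval u = ∑ a ∈ Finset.range (n + 2),
      (-1 : ℂ) ^ a * ((n + 1).factorial : ℂ) * invFactorial ((n : ℤ) + 1 - a) *
        invFactorial a ^ 2 * u ^ a := by
  rw [eval_laguerre]
  refine Finset.sum_congr rfl fun a _ => ?_
  push_cast
  rw [zero_add, add_zero]
  ring

theorem sub_mul_sum_laguerre (n : ℕ) (u v : ℂ) :
    (u - v) * ∑ l ∈ Finset.range (n + 1),
        ((2 * (l : ℂ) + 1) * ((n - l).factorial : ℂ) / ((n + l + 1).factorial : ℂ)) *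
          (u * v) ^ l * (laguerre (n - l) (2 * l + 1)).eval u *
            (laguerre (n - l) (2 * l + 1)).eval v
      = u * (laguerre n 1).eval u * (laguerre (n + 1) 0).eval v
          - v * (laguerre n 1).eval v * (laguerre (n + 1) 0).eval u := by
  have h := sum_laguerre_eq n 1 u v
  simp only [one_pow, one_mul] at h
  rw [h, mul_eval_laguerre_one, mul_eval_laguerre_one, eval_laguerre_succ_zero,
    eval_laguerre_succ_zero, mul_comm (∑ a ∈ Finset.range (n + 2), _ * v ^ a),
    Finset.sum_mul_sum, Finset.sum_mul_sum, ← Finset.sum_sub_distrib, sub_mul]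
  -- This zero extends the unshifted index to `n + 1`; the shifted one gains the index `0`, where
  -- `summand` is taken at `-1` and vanishes.
  have hz : invFactorial ((n : ℤ) - (n + 1 : ℕ)) = 0 := invFactorial_of_neg (by push_cast; omega)
  set S : ℤ → ℤ → ℂ := fun a b => ∑ l ∈ Finset.range (n + 1), summand n a b l with hS
  have hu : u * ∑ a ∈ Finset.range (n + 1), ∑ b ∈ Finset.range (n + 1),
        (-1 : ℂ) ^ a * (-1) ^ b * invFactorial ((n : ℤ) - a) * invFactorial ((n : ℤ) - b) *
          S a b * u ^ a * v ^ b
      = ∑ a ∈ Finset.range (n + 2), ∑ b ∈ Finset.range (n + 2),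
        -(-1 : ℂ) ^ a * (-1) ^ b * invFactorial ((n : ℤ) + 1 - a) * invFactorial ((n : ℤ) - b) *
          S (a - 1) b * u ^ a * v ^ b := by
    rw [Finset.sum_range_succ' _ (n + 1), Finset.mul_sum]
    simp only [Nat.cast_zero, zero_sub, hS, summand_neg_one_left, Finset.sum_const_zero,
      mul_zero, zero_mul, add_zero]
    refine Finset.sum_congr rfl fun a _ => ?_
    rw [Finset.sum_range_succ _ (n + 1), hz, Finset.mul_sum]
    simp only [mul_zero, zero_mul, add_zero]
    refine Finset.sum_congr rfl fun b _ => ?_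
    rw [show ((a + 1 : ℕ) : ℤ) - 1 = a by push_cast; ring,
      show (n : ℤ) + 1 - ((a + 1 : ℕ) : ℤ) = n - a by push_cast; ring]
    ring
  have hv : v * ∑ a ∈ Finset.range (n + 1), ∑ b ∈ Finset.range (n + 1),
        (-1 : ℂ) ^ a * (-1) ^ b * invFactorial ((n : ℤ) - a) * invFactorial ((n : ℤ) - b) *
          S a b * u ^ a * v ^ b
      = ∑ a ∈ Finset.range (n + 2), ∑ b ∈ Finset.range (n + 2),
        -(-1 : ℂ) ^ a * (-1) ^ b * invFactorial ((n : ℤ) - a) * invFactorial ((n : ℤ) + 1 - b) *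
          S a (b - 1) * u ^ a * v ^ b := by
    rw [Finset.sum_range_succ _ (n + 1), hz, Finset.mul_sum]
    simp only [mul_zero, zero_mul, add_zero, Finset.sum_const_zero]
    refine Finset.sum_congr rfl fun a _ => ?_
    rw [Finset.sum_range_succ' _ (n + 1), Finset.mul_sum]
    simp only [Nat.cast_zero, zero_sub, hS, summand_neg_one_right, Finset.sum_const_zero,
      mul_zero, zero_mul, add_zero]
    refine Finset.sum_congr rfl fun b _ => ?_
    rw [show ((b + 1 : ℕ) : ℤ) - 1 = b by push_cast; ring,
      show (n : ℤ) + 1 - ((b + 1 : ℕ) : ℤ) = n - b by push_cast; ring]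
    ring
  rw [hu, hv, ← Finset.sum_sub_distrib]
  refine Finset.sum_congr rfl fun a ha => ?_
  rw [← Finset.sum_sub_distrib, ← Finset.sum_sub_distrib]
  refine Finset.sum_congr rfl fun b hb => ?_
  have key := sum_summand_sub (n := n) (a := a) (b := b) (by simp at ha; omega)
    (by simp at hb; omega)
  -- This produces the weights `n + 1 - b` and `n + 1 - a` of `sum_summand_sub`.
  rw [invFactorial_eq_mul (j := (n : ℤ) - b) (k := (n : ℤ) + 1 - b) (by ring) rfl,
    invFactorial_eq_mul (j := (n : ℤ) - a) (k := (n : ℤ) + 1 - a) (by ring) rfl]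
  simp only [hS]
  push_cast at key ⊢
  linear_combination (-(-1 : ℂ) ^ a * (-1) ^ b * invFactorial ((n : ℤ) + 1 - a) *
    invFactorial ((n : ℤ) + 1 - b) * u ^ a * v ^ b) * key

theorem mainTheorem6 (n : ℕ) :
    -- first identity off the diagonal
    (∀ u v : ℂ, u ≠ v →
      ∑ l ∈ Finset.range (n + 1),
          ((2 * (l : ℂ) + 1) * ((n - l).factorial : ℂ) / ((n + l + 1).factorial : ℂ)) *
            (u * v) ^ l * (laguerre (n - l) (2 * l + 1)).eval u *
              (laguerre (n - l) (2 * l + 1)).eval v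
        = (u * (laguerre n 1).eval u * (laguerre (n + 1) 0).eval v
            - v * (laguerre n 1).eval v * (laguerre (n + 1) 0).eval u) / (u - v)) ∧
    -- first identity on the diagonal, where the quotient means its continuous extension
    (∀ u : ℂ,
      Tendsto
        (fun p : ℂ × ℂ =>
          (p.1 * (laguerre n 1).eval p.1 * (laguerre (n + 1) 0).eval p.2
            - p.2 * (laguerre n 1).eval p.2 * (laguerre (n + 1) 0).eval p.1) / (p.1 - p.2))
        (𝓝[{p : ℂ × ℂ | p.1 ≠ p.2}] (u, u))
        (𝓝 (∑ l ∈ Finset.range (n + 1),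
          ((2 * (l : ℂ) + 1) * ((n - l).factorial : ℂ) / ((n + l + 1).factorial : ℂ)) *
            (u * u) ^ l * (laguerre (n - l) (2 * l + 1)).eval u *
              (laguerre (n - l) (2 * l + 1)).eval u))) ∧
    -- second identity
    (∀ u v : ℂ,
      ∑ l ∈ Finset.range (n + 1),
          (-1 : ℂ) ^ l *
            ((2 * (l : ℂ) + 1) * ((n - l).factorial : ℂ) / ((n + l + 1).factorial : ℂ)) *
            (u * v) ^ l * (laguerre (n - l) (2 * l + 1)).eval u *
              (laguerre (n - l) (2 * l + 1)).eval v
        = (laguerre n 1).eval (u + v)) := by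

  have off : ∀ u v : ℂ, u ≠ v →
      ∑ l ∈ Finset.range (n + 1),
          ((2 * (l : ℂ) + 1) * ((n - l).factorial : ℂ) / ((n + l + 1).factorial : ℂ)) *
            (u * v) ^ l * (laguerre (n - l) (2 * l + 1)).eval u *
              (laguerre (n - l) (2 * l + 1)).eval v
        = (u * (laguerre n 1).eval u * (laguerre (n + 1) 0).eval v
            - v * (laguerre n 1).eval v * (laguerre (n + 1) 0).eval u) / (u - v) := by
    intro u v huv
    rw [eq_div_iff (sub_ne_zero.mpr huv), mul_comm, sub_mul_sum_laguerre]
  refine ⟨off, fun u => ?_, sum_laguerre_alternating n⟩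
  have hcont : Continuous fun p : ℂ × ℂ => ∑ l ∈ Finset.range (n + 1),
      ((2 * (l : ℂ) + 1) * ((n - l).factorial : ℂ) / ((n + l + 1).factorial : ℂ)) *
        (p.1 * p.2) ^ l * (laguerre (n - l) (2 * l + 1)).eval p.1 *
          (laguerre (n - l) (2 * l + 1)).eval p.2 := by
    fun_prop
  -- The quotient agrees off the diagonal with the left side, which is continuous everywhere.
  refine ((hcont.tendsto (u, u)).mono_left nhdsWithin_le_nhds).congr' ?_
  filter_upwards [self_mem_nhdsWithin] with p hp
  exact off p.1 p.2 hp
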